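/- Let $\alpha,\beta,\rho,\bar u,x_0>0$ be real numbers with $(\beta-\rho x_0)\bar u-\alpha x_0>0$. For $t_f>0$ consider the problem of minimising $$J(u)=\int_0^{t_f}|u(t)|\,dt$$ over all measurable controls $u:[0,t_f]\to[0,\bar u]$ for which the solution $x$ (in the Carathéodory sense, i.e. $x$ is continuous and $x(t)=x(0)+\int_0^t(-\alpha x+\beta u-\rho xu)\,d\tau$ for all $t\in[0,t_f]$) of $$\dot x(t)=-\alpha x(t)+\beta u(t)-\rho x(t)u(t),\qquad x(0)=x_0,$$ satisfies $x(t_f)=x_0$. Then, for every $t_f>0$: 1. The equation $$x_0=e^{(-\alpha-\rho\bar u)(t_f-s)}\left(x_0e^{-\alpha s}-\frac{\beta\bar u}{\alpha+\rho\bar u}\right)+\frac{\beta\bar u}{\alpha+\rho\bar u}$$ has exactly one real solution $s=t_{sw}=t_{sw}(t_f)$, and $t_{sw}\in(0,t_f)$. 2. The control $$u^*(t)=\begin{cases}0,& t\in[0,t_{sw}),\\ \bar u,& t\in[t_{sw},t_f],\end{cases}$$ is a minimiser, and it is the unique one: every minimiser equals $u^*$ almost everywhere on $[0,t_f]$. 3.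 The function $t_f\mapsto t_{sw}(t_f)$ is differentiable on $(0,\infty)$ and $$\frac{dt_{sw}}{dt_f}=1+\frac{\alpha x_0}{\bigl(\rho x_0-\beta e^{\alpha t_{sw}}\bigr)\bar u}.$$ -/

import Mathlib

namespace Furnace

/-- An admissible control on `[0, tf]`: Lebesgue measurable with values in `[0, ubar]`. -/
def IsControl (ubar tf : ℝ) (u : ℝ → ℝ) : Prop :=
  AEMeasurable u (MeasureTheory.volume.restrict (Set.Icc 0 tf)) ∧
    ∀ t ∈ Set.Icc 0 tf, u t ∈ Set.Icc 0 ubar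

/-- `x` is a Carathéodory solution on `[0, tf]` of `x' = -α x + β u - ρ x u`:
a continuous function satisfying the integral equation. -/
def IsTrajectory (α β ρ tf : ℝ) (u x : ℝ → ℝ) : Prop :=
  ContinuousOn x (Set.Icc 0 tf) ∧
    ∀ t ∈ Set.Icc 0 tf,
      x t = x 0 + ∫ τ in (0 : ℝ)..t, (-α * x τ + β * u τ - ρ * x τ * u τ)

/-- The control `u` is admissible and steers the system from `x₀` at time `0`
to `x₀` at time `tf`. -/
def IsFeasible (α β ρ ubar x₀ tf : ℝ) (u : ℝ → ℝ) : Prop :=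
  IsControl ubar tf u ∧
    ∃ x : ℝ → ℝ, IsTrajectory α β ρ tf u x ∧ x 0 = x₀ ∧ x tf = x₀

/-- The performance index (consumed energy). -/
noncomputable def cost (tf : ℝ) (u : ℝ → ℝ) : ℝ := ∫ t in (0 : ℝ)..tf, |u t|

/-- `u` solves the optimal control problem. -/
def IsOptimal (α β ρ ubar x₀ tf : ℝ) (u : ℝ → ℝ) : Prop :=
  IsFeasible α β ρ ubar x₀ tf u ∧
    ∀ v : ℝ → ℝ, IsFeasible α β ρ ubar x₀ tf v → cost tf u ≤ cost tf v

/-- The control that is `0` before time `s` and `ubar` from time `s` on. -/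
noncomputable def bangBang (ubar s : ℝ) : ℝ → ℝ := fun t => if t < s then 0 else ubar

/-- The equation for the switching time `s` belonging to the terminal time `tf`. -/
def SwitchingEq (α β ρ ubar x₀ tf s : ℝ) : Prop :=
  x₀ = Real.exp ((-α - ρ * ubar) * (tf - s)) *
      (x₀ * Real.exp (-α * s) - β * ubar / (α + ρ * ubar)) + β * ubar / (α + ρ * ubar)

end Furnace

namespace Furnace

open MeasureTheory Set

variable {α β ρ ubar x₀ tf s : ℝ} {u x : ℝ → ℝ}

/-! Optimality needs no maximum principle. With W(t) the fuel still to be spent after t, multiplying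
β/ρ - x by exp(αt - ρW) removes u from the dynamics, and integrating gives for each feasible control
(αβ/ρ) ∫ exp(αt - ρW) dt = (β/ρ - x₀)(exp(α tf) - exp(-ρ cost)), which is
`IsFeasible.integral_exp_eq`. Among controls with at most the fuel of the bang-bang control, that
control has the largest W at every t, hence the smallest left side. As β/ρ > x₀, a cheaper control
would have a smaller right side, a contradiction; at equal cost the two W must agree, which forces
the control (`IsFeasible.tail_eq_of_cost_le`, `IsControl.ae_eq_bangBang`). The switching equation
becomes F(s) = y(tf) with F strictly increasing on [0, ∞), which yields existence, uniqueness and,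
by the inverse function theorem, the derivative. -/

lemma IsControl.intervalIntegrable (hu : IsControl ubar tf u) (htf : 0 ≤ tf) :
    IntervalIntegrable u volume 0 tf := by
  rw [intervalIntegrable_iff_integrableOn_Icc_of_le htf]
  refine Integrable.of_bound hu.1.aestronglyMeasurable ubar ?_
  filter_upwards [ae_restrict_mem measurableSet_Icc] with t ht
  rw [Real.norm_eq_abs, abs_of_nonneg (hu.2 t ht).1]
  exact (hu.2 t ht).2

lemma IsControl.intervalIntegrable_of_mem (hu : IsControl ubar tf u) {a b : ℝ}
    (ha : a ∈ Icc 0 tf) (hb : b ∈ Icc 0 tf) : IntervalIntegrable u volume a b := by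
  have htf : 0 ≤ tf := ha.1.trans ha.2
  refine (hu.intervalIntegrable htf).mono_set ?_
  rw [uIcc_of_le htf]
  exact uIcc_subset_Icc ha hb

lemma IsControl.integral_nonneg (hu : IsControl ubar tf u) {a b : ℝ}
    (ha : 0 ≤ a) (hab : a ≤ b) (hb : b ≤ tf) : 0 ≤ ∫ t in a..b, u t :=
  intervalIntegral.integral_nonneg hab fun t ht => (hu.2 t ⟨ha.trans ht.1, ht.2.trans hb⟩).1

lemma IsControl.integral_le (hu : IsControl ubar tf u) {a b : ℝ}
    (ha : 0 ≤ a) (hab : a ≤ b) (hb : b ≤ tf) : ∫ t in a..b, u t ≤ ubar * (b - a) := by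
  have h := intervalIntegral.integral_mono_on hab
    (hu.intervalIntegrable_of_mem ⟨ha, hab.trans hb⟩ ⟨ha.trans hab, hb⟩)
    (intervalIntegrable_const (c := ubar) (μ := volume))
    fun t ht => (hu.2 t ⟨ha.trans ht.1, ht.2.trans hb⟩).2
  rw [intervalIntegral.integral_const, smul_eq_mul] at h
  linarith

lemma IsControl.cost_eq (hu : IsControl ubar tf u) (htf : 0 ≤ tf) :
    cost tf u = ∫ t in (0 : ℝ)..tf, u t := by
  refine intervalIntegral.integral_congr fun t ht => ?_
  rw [uIcc_of_le htf] at ht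
  exact abs_of_nonneg (hu.2 t ht).1

/-- The remaining fuel `t ↦ ∫ τ in t..tf, u τ` is Lipschitz on `[0, tf]`. -/
lemma IsControl.lipschitzOnWith_integral (hu : IsControl ubar tf u) :
    LipschitzOnWith ubar.toNNReal (fun t => ∫ τ in t..tf, u τ) (Icc 0 tf) := by
  refine LipschitzOnWith.of_le_add_mul' _ fun a ha b hb => ?_
  have htf : tf ∈ Icc 0 tf := ⟨ha.1.trans ha.2, le_rfl⟩
  have h := intervalIntegral.integral_add_adjacent_intervals
    (hu.intervalIntegrable_of_mem ha hb) (hu.intervalIntegrable_of_mem hb htf)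
  have hu0 : 0 ≤ ubar := (hu.2 a ha).1.trans (hu.2 a ha).2
  suffices ∫ t in a..b, u t ≤ ubar * dist a b by linarith
  rcases le_total a b with hab | hab
  · rw [Real.dist_eq, abs_sub_comm, abs_of_nonneg (sub_nonneg.2 hab)]
    exact hu.integral_le ha.1 hab hb.2
  · rw [intervalIntegral.integral_symm]
    have := hu.integral_nonneg hb.1 hab ha.2
    have := mul_nonneg hu0 (dist_nonneg (x := a) (y := b))
    linarith

/-! ### The balance equation -/

/-- For a merely measurable u the weight need not be differentiable everywhere; the Lipschitz bound
supplies the absolute continuity needed to integrate by parts. It holds because exp is Lipschitz on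
the compact range of the exponent. -/
lemma IsControl.lipschitzOnWith_exp (α ρ : ℝ) (hu : IsControl ubar tf u) :
    ∃ K, LipschitzOnWith K (fun t => Real.exp (α * t - ρ * ∫ τ in t..tf, u τ)) (Icc 0 tf) := by
  set φ : ℝ → ℝ := fun t => α * t - ρ * ∫ τ in t..tf, u τ with hφ
  have hlin : ∀ c : ℝ, LipschitzWith ‖c‖₊ fun y : ℝ => c * y := fun c => lipschitzWith_smul c
  have hL := ((hlin α).lipschitzOnWith (s := Icc 0 tf)).sub
    ((hlin ρ).comp_lipschitzOnWith hu.lipschitzOnWith_integral)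
  obtain ⟨a, b, hab⟩ : ∃ a b, MapsTo φ (Icc 0 tf) (Icc a b) := by
    have hc : IsCompact (φ '' Icc 0 tf) := isCompact_Icc.image_of_continuousOn hL.continuousOn
    obtain ⟨a, ha⟩ := hc.bddBelow
    obtain ⟨b, hb⟩ := hc.bddAbove
    exact ⟨a, b, fun t ht => ⟨ha (mem_image_of_mem _ ht), hb (mem_image_of_mem _ ht)⟩⟩
  obtain ⟨K, hK⟩ := (Real.contDiff_exp (n := 1)).contDiffOn (s := Icc a b)
    |>.exists_lipschitzOnWith (by decide) (convex_Icc _ _) isCompact_Icc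
  exact ⟨_, hK.comp hL hab⟩

/-- The first integral of the dynamics: along a trajectory, `(β / ρ - x) * exp (α t - ρ W)` with
`W t = ∫ τ in t..tf, u τ` has derivative `α * β / ρ * exp (α t - ρ W)`. -/
lemma IsTrajectory.integral_exp_eq (hρ : ρ ≠ 0) (htf : 0 ≤ tf) (hu : IsControl ubar tf u)
    (hx : IsTrajectory α β ρ tf u x) :
    α * β / ρ * ∫ t in (0 : ℝ)..tf, Real.exp (α * t - ρ * ∫ τ in t..tf, u τ) =
      (β / ρ - x tf) * Real.exp (α * tf) -
        (β / ρ - x 0) * Real.exp (-ρ * ∫ t in (0 : ℝ)..tf, u t) := by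
  have hui := hu.intervalIntegrable htf
  have hIcc : uIcc 0 tf = Icc 0 tf := uIcc_of_le htf
  have hxi : ContinuousOn x (uIcc 0 tf) := hIcc ▸ hx.1
  set f : ℝ → ℝ := fun τ => -α * x τ + β * u τ - ρ * x τ * u τ with hf
  have hfi : IntervalIntegrable f volume 0 tf :=
    ((hxi.const_smul (-α)).intervalIntegrable.add (hui.const_mul β)).sub
      (hui.continuousOn_mul (hxi.const_smul ρ))
  -- X agrees with x on [0, tf] and is visibly absolutely continuous there.
  set X : ℝ → ℝ := fun t => x 0 + ∫ τ in (0 : ℝ)..t, f τ with hX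
  set E : ℝ → ℝ := fun t => Real.exp (α * t - ρ * ∫ τ in t..tf, u τ) with hE
  have hconst : ∀ c : ℝ, AbsolutelyContinuousOnInterval (fun _ : ℝ => c) 0 tf := fun c =>
    contDiffOn_const.absolutelyContinuousOnInterval
  have hZac : AbsolutelyContinuousOnInterval (fun t => β / ρ - X t) 0 tf :=
    (hconst _).sub ((hconst _).add
      (hfi.absolutelyContinuousOnInterval_intervalIntegral left_mem_uIcc))
  have hEac : AbsolutelyContinuousOnInterval E 0 tf := by
    obtain ⟨K, hK⟩ := hu.lipschitzOnWith_exp α ρ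
    exact LipschitzOnWith.absolutelyContinuousOnInterval (K := K) (hIcc ▸ hK)
  have hxX : ∀ t ∈ Icc 0 tf, X t = x t := fun t ht => (hx.2 t ht).symm
  have key := hZac.integral_deriv_mul_eq_sub hEac
  rw [hxX tf ⟨htf, le_rfl⟩, hxX 0 ⟨le_rfl, htf⟩] at key
  have hE0 : E 0 = Real.exp (-ρ * ∫ t in (0 : ℝ)..tf, u t) := by simp [hE]
  have hEtf : E tf = Real.exp (α * tf) := by simp [hE]
  rw [hE0, hEtf] at key
  rw [← key, ← intervalIntegral.integral_const_mul]
  refine intervalIntegral.integral_congr_ae ?_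
  filter_upwards [hfi.ae_hasDerivAt_integral, hui.ae_hasDerivAt_integral] with t h₁ h₂ ht
  have ht' := uIoc_subset_uIcc ht
  have hZ : HasDerivAt (fun t => β / ρ - X t) (-f t) t :=
    ((h₁ ht' 0 left_mem_uIcc).const_add (x 0)).const_sub (β / ρ)
  have hW : HasDerivAt (fun t => ∫ τ in t..tf, u τ) (-u t) t := by
    simpa only [← intervalIntegral.integral_symm] using (h₂ ht' tf right_mem_uIcc).fun_neg
  have hEd : HasDerivAt E (E t * (α * 1 - ρ * -u t)) t :=
    (((hasDerivAt_id t).const_mul α).sub (hW.const_mul ρ)).exp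
  rw [hZ.deriv, hEd.deriv, hxX t (hIcc ▸ ht')]
  -- The terms in u cancel: -f + (β/ρ - x)(α + ρu) = αβ/ρ.
  simp only [hf]
  field_simp
  ring

/-- The balance equation satisfied by every feasible control. -/
lemma IsFeasible.integral_exp_eq (hρ : ρ ≠ 0) (htf : 0 ≤ tf)
    (hu : IsFeasible α β ρ ubar x₀ tf u) :
    α * β / ρ * ∫ t in (0 : ℝ)..tf, Real.exp (α * t - ρ * ∫ τ in t..tf, u τ) =
      (β / ρ - x₀) * (Real.exp (α * tf) - Real.exp (-ρ * cost tf u)) := by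
  obtain ⟨hc, x, hx, h0, h1⟩ := hu
  rw [hx.integral_exp_eq hρ htf hc, h0, h1, hc.cost_eq htf]
  ring

/-! ### Bang-bang controls and their trajectories -/

lemma isControl_bangBang (hubar : 0 ≤ ubar) : IsControl ubar tf (bangBang ubar s) := by
  refine ⟨(Measurable.ite measurableSet_Iio measurable_const measurable_const).aemeasurable,
    fun t _ => ?_⟩
  unfold bangBang
  split_ifs
  · exact ⟨le_rfl, hubar⟩
  · exact ⟨hubar, le_rfl⟩

lemma integral_bangBang_of_le {a b : ℝ} (hs : s ≤ a) (hab : a ≤ b) :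
    ∫ t in a..b, bangBang ubar s t = ubar * (b - a) := by
  have : ∫ t in a..b, bangBang ubar s t = ∫ _ in a..b, ubar := by
    refine intervalIntegral.integral_congr fun t ht => ?_
    rw [uIcc_of_le hab] at ht
    exact if_neg (hs.trans ht.1).not_gt
  rw [this, intervalIntegral.integral_const, smul_eq_mul, mul_comm]

lemma integral_bangBang_of_ge {a b : ℝ} (hab : a ≤ b) (hs : b ≤ s) :
    ∫ t in a..b, bangBang ubar s t = 0 := by
  rw [intervalIntegral.integral_of_le hab, integral_Ioc_eq_integral_Ioo,
    setIntegral_congr_fun (g := fun _ => (0 : ℝ)) measurableSet_Ioo, integral_zero]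
  intro t ht
  exact if_pos (ht.2.trans_le hs)

/-- The minimum is of the total fuel and the most that can be burnt in the remaining time, which
bounds the tail of any control with no more fuel. -/
lemma integral_bangBang_tail (hubar : 0 ≤ ubar) (hs : s ∈ Icc 0 tf) {t : ℝ} (ht : t ∈ Icc 0 tf) :
    ∫ τ in t..tf, bangBang ubar s τ = min (ubar * (tf - s)) (ubar * (tf - t)) := by
  rcases le_total s t with h | h
  · rw [integral_bangBang_of_le h ht.2, min_eq_right]
    gcongr
  · have hc : IsControl ubar tf (bangBang ubar s) := isControl_bangBang hubar
    rw [← intervalIntegral.integral_add_adjacent_intervals (hc.intervalIntegrable_of_mem ht hs)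
        (hc.intervalIntegrable_of_mem hs ⟨hs.1.trans hs.2, le_rfl⟩),
      integral_bangBang_of_ge h le_rfl, integral_bangBang_of_le le_rfl hs.2, zero_add,
      min_eq_left]
    gcongr

lemma cost_bangBang (hubar : 0 ≤ ubar) (hs : s ∈ Icc 0 tf) :
    cost tf (bangBang ubar s) = ubar * (tf - s) := by
  have htf : 0 ≤ tf := hs.1.trans hs.2
  rw [(isControl_bangBang hubar).cost_eq htf,
    integral_bangBang_tail hubar hs ⟨le_rfl, htf⟩, min_eq_left]
  have := hs.1
  gcongr

/-- The trajectory belonging to `bangBang ubar s`: free decay up to time `s`, then full heating. -/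
noncomputable def bangBangTrajectory (α β ρ ubar x₀ s : ℝ) : ℝ → ℝ := fun t =>
  if t ≤ s then x₀ * Real.exp (-α * t)
  else Real.exp ((-α - ρ * ubar) * (t - s)) *
      (x₀ * Real.exp (-α * s) - β * ubar / (α + ρ * ubar)) + β * ubar / (α + ρ * ubar)

lemma continuous_bangBangTrajectory : Continuous (bangBangTrajectory α β ρ ubar x₀ s) := by
  refine Continuous.if_le (by fun_prop) (by fun_prop) continuous_id continuous_const ?_
  rintro t rfl
  simp

lemma hasDerivAt_bangBangTrajectory (hA : α + ρ * ubar ≠ 0) {t : ℝ} (ht : t ≠ s) :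
    HasDerivAt (bangBangTrajectory α β ρ ubar x₀ s)
      (-α * bangBangTrajectory α β ρ ubar x₀ s t + β * bangBang ubar s t -
        ρ * bangBangTrajectory α β ρ ubar x₀ s t * bangBang ubar s t) t := by
  rcases ht.lt_or_gt with h | h
  · have hd : HasDerivAt (fun t => x₀ * Real.exp (-α * t))
        (x₀ * (Real.exp (-α * t) * (-α * 1))) t :=
      (((hasDerivAt_id t).const_mul (-α)).exp).const_mul x₀
    have he : bangBangTrajectory α β ρ ubar x₀ s =ᶠ[nhds t] fun t => x₀ * Real.exp (-α * t) := by
      filter_upwards [Iio_mem_nhds h] with τ hτ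
      exact if_pos (le_of_lt hτ)
    refine (hd.congr_of_eventuallyEq he).congr_deriv ?_
    simp only [bangBangTrajectory, bangBang, if_pos h, if_pos h.le]
    ring
  · have hd := ((((hasDerivAt_id t).sub_const s).const_mul (-α - ρ * ubar)).exp.mul_const
      (x₀ * Real.exp (-α * s) - β * ubar / (α + ρ * ubar))).add_const (β * ubar / (α + ρ * ubar))
    have he : bangBangTrajectory α β ρ ubar x₀ s =ᶠ[nhds t] fun t =>
        Real.exp ((-α - ρ * ubar) * (t - s)) *
          (x₀ * Real.exp (-α * s) - β * ubar / (α + ρ * ubar)) + β * ubar / (α + ρ * ubar) := by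
      filter_upwards [Ioi_mem_nhds h] with τ hτ
      exact if_neg (not_le_of_gt hτ)
    refine (hd.congr_of_eventuallyEq he).congr_deriv ?_
    simp only [bangBangTrajectory, bangBang, if_neg h.not_gt, if_neg h.not_ge, id]
    field_simp
    ring

lemma isTrajectory_bangBang (hA : α + ρ * ubar ≠ 0) (hubar : 0 ≤ ubar) :
    IsTrajectory α β ρ tf (bangBang ubar s) (bangBangTrajectory α β ρ ubar x₀ s) := by
  have hc := continuous_bangBangTrajectory (α := α) (β := β) (ρ := ρ) (ubar := ubar) (x₀ := x₀)
    (s := s)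
  refine ⟨hc.continuousOn, fun t ht => ?_⟩
  have hi := (isControl_bangBang (s := s) (tf := t) hubar).intervalIntegrable ht.1
  rw [integral_eq_of_hasDerivAt_off_countable_of_le _ _ ht.1 (countable_singleton s)
    hc.continuousOn fun τ hτ => hasDerivAt_bangBangTrajectory hA hτ.2]
  · ring
  · exact (((hc.intervalIntegrable _ _).const_mul _).add (hi.const_mul _)).sub
      (hi.continuousOn_mul (hc.const_smul ρ).continuousOn)

lemma isFeasible_bangBang (hA : α + ρ * ubar ≠ 0) (hubar : 0 ≤ ubar) (hs : s ∈ Ioo 0 tf)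
    (h : SwitchingEq α β ρ ubar x₀ tf s) : IsFeasible α β ρ ubar x₀ tf (bangBang ubar s) := by
  refine ⟨isControl_bangBang hubar, _, isTrajectory_bangBang hA hubar (x₀ := x₀), ?_, ?_⟩
  · simp [bangBangTrajectory, hs.1.le]
  · rw [bangBangTrajectory, if_neg hs.2.not_ge]
    exact h.symm

/-! ### Optimality and uniqueness -/

/-- A feasible control that is not more expensive than a feasible bang-bang control uses the
same amount of fuel, all of it after the switching time. -/
lemma IsFeasible.tail_eq_of_cost_le (hα : 0 < α) (hβ : 0 < β) (hρ : 0 < ρ) (hubar : 0 ≤ ubar)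
    (hx₀ : ρ * x₀ < β) (hs : s ∈ Ioo 0 tf)
    (hu : IsFeasible α β ρ ubar x₀ tf u) (hb : IsFeasible α β ρ ubar x₀ tf (bangBang ubar s))
    (hle : cost tf u ≤ ubar * (tf - s)) :
    cost tf u = ubar * (tf - s) ∧ ∫ t in s..tf, u t = ubar * (tf - s) := by
  have htf : 0 < tf := hs.1.trans hs.2
  have hs' : s ∈ Icc 0 tf := Ioo_subset_Icc_self hs
  have hbu := hu.integral_exp_eq hρ.ne' htf.le
  have hbb := hb.integral_exp_eq hρ.ne' htf.le
  rw [cost_bangBang hubar hs'] at hbb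
  have hz : 0 < β / ρ - x₀ := by
    rw [sub_pos, lt_div_iff₀ hρ]
    linarith
  have hk : 0 < α * β / ρ := by positivity
  obtain ⟨_, hLu⟩ := hu.1.lipschitzOnWith_exp α ρ
  obtain ⟨_, hLb⟩ := hb.1.lipschitzOnWith_exp α ρ
  have htail : ∀ t ∈ Icc 0 tf, ∫ τ in t..tf, u τ ≤ ∫ τ in t..tf, bangBang ubar s τ := by
    intro t ht
    rw [integral_bangBang_tail hubar hs' ht]
    refine le_min (le_trans ?_ hle) (hu.1.integral_le ht.1 ht.2 le_rfl)
    rw [hu.1.cost_eq htf.le, ← intervalIntegral.integral_add_adjacent_intervals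
      (hu.1.intervalIntegrable_of_mem ⟨le_rfl, htf.le⟩ ht)
      (hu.1.intervalIntegrable_of_mem ht ⟨htf.le, le_rfl⟩)]
    linarith [hu.1.integral_nonneg le_rfl ht.1 ht.2]
  have hexp : ∀ t ∈ Icc 0 tf, Real.exp (α * t - ρ * ∫ τ in t..tf, bangBang ubar s τ) ≤
      Real.exp (α * t - ρ * ∫ τ in t..tf, u τ) := by
    intro t ht
    have := htail t ht
    gcongr
  have hint := intervalIntegral.integral_mono_on htf.le
    (hLb.continuousOn.intervalIntegrable_of_Icc (μ := volume) htf.le)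
    (hLu.continuousOn.intervalIntegrable_of_Icc (μ := volume) htf.le) hexp
  have hmul := mul_le_mul_of_nonneg_left hint hk.le
  rw [hbu, hbb] at hmul
  -- Cancelling β/ρ - x₀ > 0 in the compared balance equations leaves exp(-ρ cost) to compare.
  have hcost : cost tf u = ubar * (tf - s) := by
    refine le_antisymm hle ?_
    have h1 := le_of_mul_le_mul_left hmul hz
    have h2 : Real.exp (-ρ * cost tf u) ≤ Real.exp (-ρ * (ubar * (tf - s))) := by linarith
    have h3 := Real.exp_le_exp.1 h2
    nlinarith
  refine ⟨hcost, ?_⟩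
  by_contra hne
  have hsb := integral_bangBang_tail hubar hs' hs'
  rw [min_self] at hsb
  have hlt : ∫ τ in s..tf, u τ < ∫ τ in s..tf, bangBang ubar s τ :=
    lt_of_le_of_ne (htail s hs') (hsb ▸ hne)
  -- By continuity, strictness at s alone makes the integrals differ, although equal costs make the
  -- right sides of the balance equations equal.
  have hstrict := intervalIntegral.integral_lt_integral_of_continuousOn_of_le_of_exists_lt htf
    hLb.continuousOn hLu.continuousOn (fun t ht => hexp t (Ioc_subset_Icc_self ht))
    ⟨s, hs', by gcongr⟩
  have := mul_lt_mul_of_pos_left hstrict hk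
  rw [hbu, hbb, hcost] at this
  exact lt_irrefl _ this

/-- A control with maximal fuel consumption on `[s, tf]` and none on `[0, s]` is bang-bang. -/
lemma IsControl.ae_eq_bangBang (hs : s ∈ Icc 0 tf) (hu : IsControl ubar tf u)
    (hcost : cost tf u = ubar * (tf - s)) (htail : ∫ t in s..tf, u t = ubar * (tf - s)) :
    ∀ᵐ t ∂(volume.restrict (Icc 0 tf)), u t = bangBang ubar s t := by
  have htf : 0 ≤ tf := hs.1.trans hs.2
  have hi₀ := hu.intervalIntegrable_of_mem ⟨le_rfl, htf⟩ hs
  have hi₁ := hu.intervalIntegrable_of_mem hs ⟨htf, le_rfl⟩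
  have h₀ : ∫ t in (0 : ℝ)..s, u t = 0 := by
    rw [hu.cost_eq htf, ← intervalIntegral.integral_add_adjacent_intervals hi₀ hi₁] at hcost
    linarith
  have h₁ : ∫ t in s..tf, (ubar - u t) = 0 := by
    rw [intervalIntegral.integral_sub intervalIntegrable_const hi₁, htail,
      intervalIntegral.integral_const, smul_eq_mul]
    ring
  rw [intervalIntegral.integral_eq_zero_iff_of_le_of_nonneg_ae hs.1 _ hi₀] at h₀
  · rw [intervalIntegral.integral_eq_zero_iff_of_le_of_nonneg_ae hs.2 _
      (intervalIntegrable_const.sub hi₁)] at h₁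
    · rw [← restrict_Ioc_eq_restrict_Icc, ae_restrict_iff' measurableSet_Ioc]
      rw [Filter.EventuallyEq, ae_restrict_iff' measurableSet_Ioc] at h₀ h₁
      have hne : ∀ᵐ t : ℝ, t ≠ s := by simp [ae_iff, measure_singleton]
      filter_upwards [h₀, h₁, hne] with t ht₀ ht₁ hts ht
      rcases hts.lt_or_gt with h | h
      · rw [bangBang, if_pos h]
        exact ht₀ ⟨ht.1, h.le⟩
      · rw [bangBang, if_neg h.not_gt]
        exact (sub_eq_zero.1 (ht₁ ⟨h, ht.2⟩)).symm
    · filter_upwards [ae_restrict_mem measurableSet_Ioc] with t ht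
      exact sub_nonneg.2 (hu.2 t ⟨hs.1.trans ht.1.le, ht.2⟩).2
  · filter_upwards [ae_restrict_mem measurableSet_Ioc] with t ht
    exact (hu.2 t ⟨ht.1.le, ht.2.trans hs.2⟩).1

/-! ### The switching equation -/

/-- The left-hand side of the switching equation after clearing denominators and collecting the
terms that contain the switching time. -/
noncomputable def switchFun (α β ρ ubar x₀ s : ℝ) : ℝ :=
  β * ubar * Real.exp ((α + ρ * ubar) * s) - (α + ρ * ubar) * x₀ * Real.exp (ρ * ubar * s)

/-- Separates s from tf, so that solving for s means inverting one fixed function. -/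
lemma switchingEq_iff (hA : α + ρ * ubar ≠ 0) :
    SwitchingEq α β ρ ubar x₀ tf s ↔
      switchFun α β ρ ubar x₀ s =
        (β * ubar - (α + ρ * ubar) * x₀) * Real.exp ((α + ρ * ubar) * tf) := by
  have h₁ : Real.exp ((-α - ρ * ubar) * (tf - s)) =
      Real.exp ((α + ρ * ubar) * s) / Real.exp ((α + ρ * ubar) * tf) := by
    rw [← Real.exp_sub]
    ring_nf
  have h₂ : Real.exp (-α * s) = Real.exp (ρ * ubar * s) / Real.exp ((α + ρ * ubar) * s) := by
    rw [← Real.exp_sub]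
    ring_nf
  rw [SwitchingEq, switchFun, h₁, h₂]
  have := Real.exp_ne_zero ((α + ρ * ubar) * s)
  have := Real.exp_ne_zero ((α + ρ * ubar) * tf)
  generalize Real.exp ((α + ρ * ubar) * s) = a at *
  generalize Real.exp ((α + ρ * ubar) * tf) = b at *
  generalize Real.exp (ρ * ubar * s) = c at *
  generalize hAd : α + ρ * ubar = A at *
  field_simp
  constructor <;> intro h <;> linarith

lemma switchFun_eq : switchFun α β ρ ubar x₀ s =
    Real.exp (ρ * ubar * s) * (β * ubar * Real.exp (α * s) - (α + ρ * ubar) * x₀) := by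
  rw [switchFun, add_mul α, Real.exp_add]
  ring

lemma hasStrictDerivAt_switchFun :
    HasStrictDerivAt (switchFun α β ρ ubar x₀)
      ((α + ρ * ubar) * (ubar * Real.exp (ρ * ubar * s) * (β * Real.exp (α * s) - ρ * x₀))) s := by
  have h₁ := (((hasStrictDerivAt_id s).const_mul (α + ρ * ubar)).exp.const_mul (β * ubar)).sub
    (((hasStrictDerivAt_id s).const_mul (ρ * ubar)).exp.const_mul ((α + ρ * ubar) * x₀))
  refine h₁.congr_deriv ?_
  simp only [id]
  rw [add_mul α (ρ * ubar) s, Real.exp_add]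
  ring

/-- The derivative has the sign of β exp(αs) - ρx₀, positive for s ≥ 0 but possibly negative for s
far below 0. -/
lemma strictMonoOn_switchFun (hα : 0 < α) (hβ : 0 < β) (hρ : 0 < ρ) (hubar : 0 < ubar)
    (hx₀ : ρ * x₀ < β) : StrictMonoOn (switchFun α β ρ ubar x₀) (Ici 0) := by
  refine strictMonoOn_of_deriv_pos (convex_Ici 0)
    (fun s _ => hasStrictDerivAt_switchFun.hasDerivAt.continuousAt.continuousWithinAt) ?_
  intro s hs
  rw [interior_Ici, mem_Ioi] at hs
  rw [hasStrictDerivAt_switchFun.hasDerivAt.deriv]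
  have : 0 < β * Real.exp (α * s) - ρ * x₀ := by
    nlinarith [Real.one_lt_exp_iff.2 (mul_pos hα hs)]
  positivity

/-- Excludes solutions s ≤ 0, where monotonicity may fail: for tf > 0 the target value exceeds this
bound. -/
lemma switchFun_le_of_nonpos (hα : 0 < α) (hβ : 0 < β) (hρ : 0 < ρ) (hubar : 0 < ubar)
    (hass : 0 < (β - ρ * x₀) * ubar - α * x₀) (hs : s ≤ 0) :
    switchFun α β ρ ubar x₀ s ≤ β * ubar - (α + ρ * ubar) * x₀ := by
  rw [switchFun_eq]
  have h₁ : Real.exp (ρ * ubar * s) ≤ 1 :=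
    Real.exp_le_one_iff.2 (mul_nonpos_of_nonneg_of_nonpos (by positivity) hs)
  have h₂ : Real.exp (α * s) ≤ 1 :=
    Real.exp_le_one_iff.2 (mul_nonpos_of_nonneg_of_nonpos hα.le hs)
  have h₃ : β * ubar * Real.exp (α * s) ≤ β * ubar :=
    mul_le_of_le_one_right (by positivity) h₂
  calc _ ≤ Real.exp (ρ * ubar * s) * (β * ubar - (α + ρ * ubar) * x₀) := by gcongr
    _ ≤ _ := mul_le_of_le_one_left (by linarith) h₁

/-- The switching equation has exactly one real solution, and it lies in `(0, tf)`. -/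
lemma exists_switchingEq_iff (hα : 0 < α) (hβ : 0 < β) (hρ : 0 < ρ) (hubar : 0 < ubar)
    (hx₀ : 0 < x₀) (hass : 0 < (β - ρ * x₀) * ubar - α * x₀) (htf : 0 < tf) :
    ∃ s ∈ Ioo 0 tf, ∀ r, SwitchingEq α β ρ ubar x₀ tf r ↔ r = s := by
  have hA : 0 < α + ρ * ubar := by positivity
  have hD : 0 < β * ubar - (α + ρ * ubar) * x₀ := by linarith
  have hβx : ρ * x₀ < β := by nlinarith [mul_pos hα hx₀]
  set y := (β * ubar - (α + ρ * ubar) * x₀) * Real.exp ((α + ρ * ubar) * tf) with hy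
  have hy₀ : β * ubar - (α + ρ * ubar) * x₀ < y :=
    lt_mul_of_one_lt_right hD (Real.one_lt_exp_iff.2 (mul_pos hA htf))
  -- The gap is (α + ρ ubar) x₀ exp(ρ ubar tf) (exp(α tf) - 1).
  have hy₁ : y < switchFun α β ρ ubar x₀ tf := by
    rw [hy, switchFun_eq, add_mul α _ tf, Real.exp_add]
    have h₁ := Real.one_lt_exp_iff.2 (mul_pos hα htf)
    have h₂ := mul_lt_mul_of_pos_left h₁
      (mul_pos (Real.exp_pos (ρ * ubar * tf)) (mul_pos hA hx₀))
    linarith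
  have hmono := strictMonoOn_switchFun hα hβ hρ hubar hβx
  have hcont : Continuous (switchFun α β ρ ubar x₀) :=
    continuous_iff_continuousAt.2 fun _ => hasStrictDerivAt_switchFun.hasDerivAt.continuousAt
  have h0 : switchFun α β ρ ubar x₀ 0 = β * ubar - (α + ρ * ubar) * x₀ := by simp [switchFun]
  obtain ⟨s, hs, hsy⟩ := intermediate_value_Ioo htf.le hcont.continuousOn ⟨h0 ▸ hy₀, hy₁⟩
  refine ⟨s, hs, fun r => ?_⟩
  rw [switchingEq_iff hA.ne', ← hy]
  refine ⟨fun hr => ?_, fun hr => hr ▸ hsy⟩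
  have hr0 : 0 ≤ r := by
    by_contra! hneg
    linarith [switchFun_le_of_nonpos hα hβ hρ hubar hass hneg.le]
  exact hmono.injOn hr0 hs.1.le (hr.trans hsy.symm)

/-- Implicit differentiation of the switching equation. -/
lemma hasDerivAt_switchingTime (hα : 0 < α) (hβ : 0 < β) (hρ : 0 < ρ) (hubar : 0 < ubar)
    (hx₀ : 0 < x₀) (hass : 0 < (β - ρ * x₀) * ubar - α * x₀) {tsw : ℝ → ℝ}
    (htsw : ∀ t, 0 < t → ∀ r, SwitchingEq α β ρ ubar x₀ t r ↔ r = tsw t)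
    (htf : 0 < tf) (hpos : 0 < tsw tf) :
    HasDerivAt tsw (1 + α * x₀ / ((ρ * x₀ - β * Real.exp (α * tsw tf)) * ubar)) tf := by
  have hA : 0 < α + ρ * ubar := by positivity
  have hβx : ρ * x₀ < β := by nlinarith [mul_pos hα hx₀]
  have hd : 0 < β * Real.exp (α * tsw tf) - ρ * x₀ := by
    nlinarith [Real.one_lt_exp_iff.2 (mul_pos hα hpos)]
  have hF := hasStrictDerivAt_switchFun (α := α) (β := β) (ρ := ρ) (ubar := ubar) (x₀ := x₀)
    (s := tsw tf)
  have hF' : (α + ρ * ubar) * (ubar * Real.exp (ρ * ubar * tsw tf) *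
      (β * Real.exp (α * tsw tf) - ρ * x₀)) ≠ 0 := by positivity
  have heq := (switchingEq_iff hA.ne').1 ((htsw tf htf _).2 rfl)
  set y : ℝ → ℝ := fun t =>
    (β * ubar - (α + ρ * ubar) * x₀) * Real.exp ((α + ρ * ubar) * t) with hy
  have hyd : HasDerivAt y ((β * ubar - (α + ρ * ubar) * x₀) *
      (Real.exp ((α + ρ * ubar) * tf) * ((α + ρ * ubar) * 1))) tf :=
    ((hasDerivAt_id tf).const_mul (α + ρ * ubar)).exp.const_mul _
  have hinv := (hF.to_localInverse hF').hasDerivAt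
  have hright := hF.eventually_right_inverse hF'
  rw [heq] at hinv hright
  have hcomp := HasDerivAt.comp tf hinv hyd
  refine (hcomp.congr_of_eventuallyEq ?_).congr_deriv ?_
  -- Global uniqueness identifies `tsw` with the local inverse composed with y near tf, so
  -- continuity of `tsw` need not be known beforehand.
  · filter_upwards [hyd.continuousAt.eventually hright, Ioi_mem_nhds htf] with t ht ht₀
    exact ((htsw t ht₀ _).1 ((switchingEq_iff hA.ne').2 ht)).symm
  -- Since y' = (α + ρ ubar) y and y(tf) is the value of `switchFun` at the switching time, tf drops
  -- out.
  · have hval : (β * ubar - (α + ρ * ubar) * x₀) *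
        (Real.exp ((α + ρ * ubar) * tf) * ((α + ρ * ubar) * 1)) = (α + ρ * ubar) *
        (Real.exp (ρ * ubar * tsw tf) *
          (β * ubar * Real.exp (α * tsw tf) - (α + ρ * ubar) * x₀)) := by
      rw [← switchFun_eq, heq]
      ring
    rw [hval]
    have hd' : ρ * x₀ - β * Real.exp (α * tsw tf) ≠ 0 := by linarith
    have := Real.exp_ne_zero (ρ * ubar * tsw tf)
    generalize Real.exp (ρ * ubar * tsw tf) = a at *
    generalize Real.exp (α * tsw tf) = b at *
    rw [inv_mul_eq_div, mul_div_mul_left _ _ hA.ne', mul_assoc ubar, mul_left_comm ubar,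
      mul_div_mul_left _ _ this, ← neg_sub (ρ * x₀)]
    field_simp
    ring

end Furnace

theorem theorem2 (α β ρ ubar x₀ : ℝ) (hα : 0 < α) (hβ : 0 < β) (hρ : 0 < ρ)
    (hubar : 0 < ubar) (hx₀ : 0 < x₀) (hass : 0 < (β - ρ * x₀) * ubar - α * x₀) :
    ∃ tsw : ℝ → ℝ, ∀ tf : ℝ, 0 < tf →
      tsw tf ∈ Set.Ioo 0 tf ∧
      Furnace.IsOptimal α β ρ ubar x₀ tf (Furnace.bangBang ubar (tsw tf)) ∧
      (∀ u : ℝ → ℝ, Furnace.IsOptimal α β ρ ubar x₀ tf u →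
        ∀ᵐ t ∂(MeasureTheory.volume.restrict (Set.Icc 0 tf)),
          u t = Furnace.bangBang ubar (tsw tf) t) ∧
      (∀ s : ℝ, Furnace.SwitchingEq α β ρ ubar x₀ tf s ↔ s = tsw tf) ∧
      HasDerivAt tsw
        (1 + α * x₀ / ((ρ * x₀ - β * Real.exp (α * tsw tf)) * ubar)) tf := by
  have hA : 0 < α + ρ * ubar := by positivity
  have hβx : ρ * x₀ < β := by nlinarith [mul_pos hα hx₀]
  have hex : ∀ tf : ℝ, ∃ s, 0 < tf →
      s ∈ Set.Ioo 0 tf ∧ ∀ r, Furnace.SwitchingEq α β ρ ubar x₀ tf r ↔ r = s := by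
    intro tf
    by_cases htf : 0 < tf
    · obtain ⟨s, hs⟩ := Furnace.exists_switchingEq_iff hα hβ hρ hubar hx₀ hass htf
      exact ⟨s, fun _ => hs⟩
    -- The value for tf ≤ 0 is arbitrary; a derivative at tf > 0 sees only nearby positive times.
    · exact ⟨0, fun h => absurd h htf⟩
  choose tsw htsw using hex
  refine ⟨tsw, fun tf htf => ?_⟩
  obtain ⟨hmem, hiff⟩ := htsw tf htf
  have hmem' := Set.Ioo_subset_Icc_self hmem
  have hfeas := Furnace.isFeasible_bangBang hA.ne' hubar.le hmem ((hiff _).2 rfl)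
  have hcost := Furnace.cost_bangBang hubar.le hmem'
  refine ⟨hmem, ⟨hfeas, fun v hv => ?_⟩, fun u hu => ?_, hiff, ?_⟩
  · rw [hcost]
    rcases le_total (Furnace.cost tf v) (ubar * (tf - tsw tf)) with h | h
    · exact (hv.tail_eq_of_cost_le hα hβ hρ hubar.le hβx hmem hfeas h).1.ge
    · exact h
  · obtain ⟨h₁, h₂⟩ := hu.1.tail_eq_of_cost_le hα hβ hρ hubar.le hβx hmem hfeas
      (hcost ▸ hu.2 _ hfeas)
    exact hu.1.1.ae_eq_bangBang hmem' h₁ h₂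
  · exact Furnace.hasDerivAt_switchingTime hα hβ hρ hubar hx₀ hass
      (fun t ht => (htsw t ht).2) htf hmem.1
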